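/- Circuits are Boolean circuits whose gates have fan-in two and compute arbitrary binary Boolean operations; the size of a circuit is its number of gates (inputs are not counted). There are absolute constants $c,a,b>0$ and $N\in\mathbb N$, and for every $\varepsilon>0$ a constant $K_\varepsilon>0$ depending only on $\varepsilon$, such that the following holds. Let $\delta\in(0,0.49)$, $\gamma\in(0,\tfrac12)$, and let $n\ge N$ and $s$ be natural numbers with $n\le s\le c\,\tfrac{2^n}{n}$ and $s\ge 1/\gamma^{2+\varepsilon}$. Then there are an integer $0\le k<n$ with $a\,s\log_2 s\le 2^k\le b\,s\log_2 s$ and a function $f:\{0,1\}^n\to\{0,1\}$ depending only on the first $k$ input bits such that 1. for every circuit $C$ of size at most $s$, $\Pr_{x\sim\{0,1\}^n}[C(x)=f(x)]\le 1-\delta$, where $x$ is uniform; 2. for every probability distribution $H$ on $\{0,1\}^n$, there is a circuit $C$ of size at most $K_\varepsilon\, s\gamma^2$ with $\Pr_{x\sim H}[C(x)=f(x)]\ge\tfrac12+\gamma$. Moreover, if $g:\{0,1\}^k\to\{0,1\}$ is uniformly random, then the function $f(x)=g(x_1,\dots,x_k)$ satisfies both 1 and 2 with probability at least $1-2^{-s}$.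 -/

import Mathlib

namespace HardcoreTightness

/-- A gate of fan-in two reading two of the `m` wires available so far and computing an arbitrary
binary Boolean operation of them. -/
structure Gate (m : ℕ) where
  op : Bool → Bool → Bool
  left : Fin m
  right : Fin m

/-- A sequence of `m` gates on top of `n` input wires. The gate added as number `m` may read
the `n` inputs and the outputs of the `m` gates before it, and its output is the wire `n + m`. -/
inductive GateSeq (n : ℕ) : ℕ → Type
  | nil : GateSeq n 0
  | snoc {m : ℕ} (c : GateSeq n m) (g : Gate (n + m)) : GateSeq n (m + 1)

/-- The values of all wires (inputs first, then gates in order) on the input `x`. -/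
def GateSeq.wires {n : ℕ} (x : Fin n → Bool) : {m : ℕ} → GateSeq n m → (Fin (n + m) → Bool)
  | _, .nil => x
  | _, .snoc c g =>
      Fin.snoc (α := fun _ => Bool) (c.wires x)
        (g.op (c.wires x g.left) (c.wires x g.right))

/-- A Boolean circuit with `n` inputs over the full basis of binary operations (unbounded fan-out).
Its size is its number of gates; input wires are not counted. -/
structure Circuit (n : ℕ) where
  size : ℕ
  gates : GateSeq n size
  out : Fin (n + size)

/-- The Boolean function computed by a circuit. -/
def Circuit.eval {n : ℕ} (C : Circuit n) (x : Fin n → Bool) : Bool :=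
  C.gates.wires x C.out

/-- The probability, as a real number, of the event `P` under the distribution `p`. -/
noncomputable def prob {α : Type*} (p : PMF α) (P : α → Prop) : ℝ :=
  (p.toOuterMeasure {a | P a}).toReal

/-- Every circuit of size at most `s` agrees with `f` on at most a `1 - δ` fraction of inputs. -/
def IsHard {n : ℕ} (f : (Fin n → Bool) → Bool) (s : ℕ) (δ : ℝ) : Prop :=
  ∀ C : Circuit n, C.size ≤ s →
    prob (PMF.uniformOfFintype (Fin n → Bool)) (fun x => C.eval x = f x) ≤ 1 - δ

/-- For every distribution `H` on the cube, some circuit of size at most `S` agrees with `f` with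
probability at least `1 / 2 + γ` over `H`. -/
def IsCorrelatedOnAll {n : ℕ} (f : (Fin n → Bool) → Bool) (S γ : ℝ) : Prop :=
  ∀ H : PMF (Fin n → Bool), ∃ C : Circuit n, (C.size : ℝ) ≤ S ∧
    1 / 2 + γ ≤ prob H (fun x => C.eval x = f x)

/-- The function on `n` bits that applies `g` to the first `k` bits. -/
def junta {k n : ℕ} (h : k ≤ n) (g : (Fin k → Bool) → Bool) : (Fin n → Bool) → Bool :=
  fun x => g (fun i => x (Fin.castLE h i))

end HardcoreTightness

open HardcoreTightness

/-! Take `2 ^ k` of order `s log s`. Hardness comes from counting: a fixed circuit agrees too well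
with a random junta with probability `exp (-Ω(2 ^ k))`, which beats the `s ^ O(s)` circuits of size
at most `s` (`le_prob_isHard`).

Correlation holds for every `g`, with no randomness. Split the `k` bits into `y` (`m` bits) and `z`
(`l` bits) with `2 ^ l` of order `1 / γ ^ 2`, and predict `g` by `T y xor q z`, where `q` is a
quadratic form over the two-element field. The signs of a random `q` have the second and fourth
moments needed for a Khintchine inequality, so on each block `y` the expected absolute correlation
is at least half the 2-norm of the weights, hence at least `2γ` times their mass. Averaging fixes
one `q` for all blocks, and `T` supplies the sign in each (`exists_quadForm_correlation`).

Computing `T` costs `O(2 ^ m / m)` by Shannon's construction, and `q` costs `O(l ^ 2)`. Here `2 ^ m`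
is of order `s γ ^ 2 log s`. The bound `s ≥ 1 / γ ^ (2 + ε)` makes `s γ ^ 2` at least a fixed power
of `s`, so `m` is of order `log s`, which cancels the logarithm, and `l ^ 2` is absorbed
(`isCorrelatedOnAll_of_parameters`). -/

namespace HardcoreTightness

/-! ### Generating Boolean functions by circuits -/

section Generates

variable {n : ℕ}

/-- The functions computed by the wires of a gate sequence. -/
def GateSeq.wireFns {m : ℕ} (c : GateSeq n m) : Set ((Fin n → Bool) → Bool) :=
  Set.range fun i x => c.wires x i

/-- Every gate sequence computing all functions in `A` can be extended by at most `t` gates so as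
to compute all functions in `B`. -/
def Generates (A B : Set ((Fin n → Bool) → Bool)) (t : ℕ) : Prop :=
  ∀ (m : ℕ) (c : GateSeq n m), A ⊆ c.wireFns →
    ∃ m' ≤ m + t, ∃ c' : GateSeq n m', c.wireFns ⊆ c'.wireFns ∧ B ⊆ c'.wireFns

variable {A A' B B' : Set ((Fin n → Bool) → Bool)} {t t' : ℕ}

lemma Generates.of_subset (h : B ⊆ A) : Generates A B 0 :=
  fun m c hc => ⟨m, le_rfl, c, subset_rfl, h.trans hc⟩

lemma Generates.mono (h : Generates A B t) (hA : A ⊆ A') (hB : B' ⊆ B) (ht : t ≤ t') :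
    Generates A' B' t' := by
  intro m c hc
  obtain ⟨m', hm', c', h1, h2⟩ := h m c (hA.trans hc)
  exact ⟨m', by omega, c', h1, hB.trans h2⟩

/-- The second stage reads the outputs of the first for free, so a shared subfunction is paid for
once. -/
lemma Generates.trans (h : Generates A B t) (h' : Generates (A ∪ B) B' t') :
    Generates A (B ∪ B') (t + t') := by
  intro m c hc
  obtain ⟨m₁, hm₁, c₁, h1, h2⟩ := h m c hc
  obtain ⟨m₂, hm₂, c₂, h3, h4⟩ := h' m₁ c₁ (Set.union_subset (hc.trans h1) h2)
  exact ⟨m₂, by omega, c₂, h1.trans h3, Set.union_subset (h2.trans h3) h4⟩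

lemma Generates.union (h : Generates A B t) (h' : Generates A B' t') :
    Generates A (B ∪ B') (t + t') :=
  h.trans (h'.mono Set.subset_union_left subset_rfl le_rfl)

lemma GateSeq.wireFns_snoc {m : ℕ} (c : GateSeq n m) (g : Gate (n + m)) :
    (GateSeq.snoc c g).wireFns =
      insert (fun x => g.op (c.wires x g.left) (c.wires x g.right)) c.wireFns := by
  ext f
  simp only [GateSeq.wireFns, Set.mem_range, Set.mem_insert_iff]
  constructor
  · rintro ⟨i, rfl⟩
    induction i using Fin.lastCases with
    | last => left; funext x; simp [GateSeq.wires]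
    | cast i => right; exact ⟨i, by funext x; simp [GateSeq.wires]⟩
  · rintro (rfl | ⟨i, rfl⟩)
    · exact ⟨Fin.last _, by funext x; simp [GateSeq.wires]⟩
    · exact ⟨Fin.castSucc i, by funext x; simp [GateSeq.wires]⟩

lemma Generates.gate {u v : (Fin n → Bool) → Bool} (op : Bool → Bool → Bool) (hu : u ∈ A)
    (hv : v ∈ A) : Generates A {fun x => op (u x) (v x)} 1 := by
  intro m c hc
  obtain ⟨i, hi⟩ := hc hu
  obtain ⟨j, hj⟩ := hc hv
  refine ⟨m + 1, le_rfl, .snoc c ⟨op, i, j⟩, ?_, ?_⟩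
  · rw [GateSeq.wireFns_snoc]
    exact Set.subset_insert _ _
  · rw [GateSeq.wireFns_snoc, ← hi, ← hj]
    exact Set.singleton_subset_iff.2 (Set.mem_insert _ _)

lemma Generates.gate₂ {u v : (Fin n → Bool) → Bool} (op : Bool → Bool → Bool)
    (hu : Generates A {u} t) (hv : Generates A {v} t') :
    Generates A {fun x => op (u x) (v x)} (t + t' + 1) :=
  ((hu.union hv).trans (Generates.gate op (u := u) (v := v) (by simp) (by simp))).mono
    subset_rfl Set.subset_union_right le_rfl

lemma Generates.const {u : (Fin n → Bool) → Bool} (hu : u ∈ A) (b : Bool) :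
    Generates A {fun _ => b} 1 :=
  Generates.gate (fun _ _ => b) hu hu

lemma Generates.iUnion {ι : Type*} [Fintype ι] {B : ι → Set ((Fin n → Bool) → Bool)}
    (h : ∀ i, Generates A (B i) t) : Generates A (⋃ i, B i) (Fintype.card ι * t) := by
  classical
  have key : ∀ s : Finset ι, Generates A (⋃ i ∈ s, B i) (s.card * t) := by
    intro s
    induction s using Finset.induction_on with
    | empty => exact Generates.of_subset (by simp) |>.mono subset_rfl subset_rfl (by simp)
    | insert a s ha ih =>
      refine ((h a).union ih).mono subset_rfl ?_ ?_
      · simp [Set.iUnion_or, Set.iUnion_union_distrib]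
      · rw [Finset.card_insert_of_notMem ha]; ring_nf; rfl
  simpa using key Finset.univ

/-- A multiplexer tree. -/
lemma Generates.mux {j : ℕ} (v : Fin j → (Fin n → Bool) → Bool)
    (L : (Fin j → Bool) → (Fin n → Bool) → Bool) (hv : ∀ i, v i ∈ A) (hL : ∀ b, L b ∈ A) :
    Generates A {fun x => L (fun i => v i x) x} (3 * (2 ^ j - 1)) := by
  induction j with
  | zero =>
    refine (Generates.of_subset ?_).mono subset_rfl subset_rfl (Nat.zero_le _)
    rw [Set.singleton_subset_iff]
    convert hL (fun i => i.elim0) using 3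
  | succ j ih =>
    have h1 := ih (fun i => v i.succ) (fun b => L (Fin.cons true b)) (fun i => hv _)
      (fun b => hL _)
    have h0 := ih (fun i => v i.succ) (fun b => L (Fin.cons false b)) (fun i => hv _)
      (fun b => hL _)
    have hs : Generates A {v 0} 0 := Generates.of_subset (by simpa using hv 0)
    have := (Generates.gate₂ and hs h1).gate₂ or
      (Generates.gate₂ (fun a b => !a && b) hs h0)
    refine this.mono subset_rfl ?_ ?_
    · rw [Set.singleton_subset_iff, Set.mem_singleton_iff]
      funext x
      have hx : (fun i => v i x) = Fin.cons (v 0 x) (fun i : Fin j => v i.succ x) := by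
        funext i
        refine Fin.cases ?_ (fun i => ?_) i <;> simp
      rw [hx]
      cases v 0 x <;> simp
    · have := Nat.one_le_two_pow (n := j)
      rw [pow_succ]
      omega

/-- Shannon's construction. -/
lemma Generates.shannon {j r : ℕ} (v : Fin (j + r) → (Fin n → Bool) → Bool)
    (hv : ∀ i, v i ∈ A) {u : (Fin n → Bool) → Bool} (hu : u ∈ A)
    (T : (Fin (j + r) → Bool) → Bool) :
    Generates A {fun x => T (fun i => v i x)} (2 + 2 ^ 2 ^ r * (3 * 2 ^ r) + 3 * 2 ^ j) := by
  set consts : Set ((Fin n → Bool) → Bool) := {fun _ => true} ∪ {fun _ => false}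
  have h0 : Generates A consts 2 := (Generates.const hu true).union (Generates.const hu false)
  -- All functions of the last `r` bits are built once; a multiplexer on the first `j` bits then
  -- selects the restriction of `T`.
  have h1 : ∀ F : (Fin r → Bool) → Bool,
      Generates (A ∪ consts) {fun x => F (fun i => v (Fin.natAdd j i) x)} (3 * 2 ^ r) := by
    intro F
    refine (Generates.mux (fun i => v (Fin.natAdd j i)) (fun b _ => F b) (fun i => .inl (hv _))
      (fun b => .inr ?_)).mono subset_rfl subset_rfl (by omega)
    cases h : F b <;> simp [consts]
  have h2 := h0.trans (Generates.iUnion h1)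
  refine (h2.trans (Generates.mux (fun i : Fin j => v (Fin.castAdd r i))
    (fun b x => T (Fin.append b (fun i => v (Fin.natAdd j i) x))) (fun i => .inl (hv _))
    (fun b => .inr (.inr ?_)))).mono subset_rfl ?_ ?_
  · exact Set.mem_iUnion.2 ⟨fun z => T (Fin.append b z), rfl⟩
  · rw [Set.singleton_subset_iff]
    right
    rw [Set.mem_singleton_iff]
    funext x
    congr 1
    funext i
    refine Fin.addCases (fun i => ?_) (fun i => ?_) i <;> simp
  · simp only [Fintype.card_pi, Fintype.card_bool, Finset.prod_const, Finset.card_univ,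
      Fintype.card_fin]
    omega

/-- The quadratic form over the two-element field with coefficients `a`. -/
def quadForm {l : ℕ} (a : Fin l × Fin l → Bool) (z : Fin l → Bool) : Bool :=
  (List.ofFn fun i : Fin l => (List.ofFn fun j : Fin l =>
    a (i, j) && (z i && z j)).foldr xor false).foldr xor false

lemma Generates.foldr_xor {u : (Fin n → Bool) → Bool} (hu : u ∈ A) {l : ℕ}
    (F : Fin l → (Fin n → Bool) → Bool) (hF : ∀ i, Generates A {F i} t) :
    Generates A {fun x => (List.ofFn fun i => F i x).foldr xor false} (l * (t + 1) + 1) := by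
  induction l with
  | zero => simpa using Generates.const hu false
  | succ l ih =>
    have := (hF 0).gate₂ xor (ih (fun i => F i.succ) (fun i => hF _))
    simp only [List.ofFn_succ, List.foldr_cons]
    exact this.mono subset_rfl subset_rfl (by ring_nf; omega)

lemma Generates.quadForm {l : ℕ} (a : Fin l × Fin l → Bool) (v : Fin l → (Fin n → Bool) → Bool)
    (hv : ∀ i, v i ∈ A) {u : (Fin n → Bool) → Bool} (hu : u ∈ A) :
    Generates A {fun x => HardcoreTightness.quadForm a (fun i => v i x)}
      (l * (l * 2 + 2) + 1) := by
  refine Generates.foldr_xor (t := l * 2 + 1) hu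
    (fun i x => (List.ofFn fun j => a (i, j) && (v i x && v j x)).foldr xor false) fun i => ?_
  exact Generates.foldr_xor (t := 1) hu (fun j x => a (i, j) && (v i x && v j x))
    fun j => Generates.gate (fun p q => a (i, j) && (p && q)) (hv i) (hv j)

lemma Generates.exists_circuit {f : (Fin n → Bool) → Bool}
    (h : Generates (Set.range fun i x => x i) {f} t) :
    ∃ C : Circuit n, C.size ≤ t ∧ C.eval = f := by
  obtain ⟨m, hm, c, -, hc⟩ := h 0 .nil (by simp [GateSeq.wireFns, GateSeq.wires])
  obtain ⟨i, hi⟩ := Set.singleton_subset_iff.1 hc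
  exact ⟨⟨m, c, i⟩, by simpa using hm, hi⟩

end Generates

/-! ### Balancing the two stages of Shannon's construction. -/

lemma two_mul_add_one_sq_le (q : ℕ) : (2 * q + 1) ^ 2 ≤ 16 * 2 ^ q := by
  induction q with
  | zero => norm_num
  | succ q ih =>
    by_cases hq : q ≤ 2
    · interval_cases q <;> norm_num
    · rw [pow_succ 2 q]
      nlinarith

/-- With `2 ^ r` between about `m / 4` and `m / 2`, the table of all `r`-bit functions costs about
`2 ^ (m / 2)` up to polynomial factors, and the multiplexer costs `O(2 ^ m / 2 ^ r)`. -/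
lemma exists_shannon_split {m : ℕ} (hm : 2 ≤ m) : ∃ j r : ℕ, m = j + r ∧
    ((2 + 2 ^ 2 ^ r * (3 * 2 ^ r) + 3 * 2 ^ j : ℕ) : ℝ) ≤ 68 * (2 ^ m / m) := by
  obtain ⟨r, hr⟩ : ∃ r, r = Nat.log 2 (m / 2) := ⟨_, rfl⟩
  have h1 : 2 ^ r ≤ m / 2 := hr ▸ Nat.pow_log_le_self 2 (by omega)
  have h2 : m / 2 < 2 ^ (r + 1) := hr ▸ Nat.lt_pow_succ_log_self (by norm_num) _
  have hrm : r < m := lt_of_lt_of_le Nat.lt_two_pow_self (h1.trans (Nat.div_le_self _ _))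
  refine ⟨m - r, r, by omega, ?_⟩
  have hm0 : (0 : ℝ) < m := by positivity
  rw [mul_div_assoc', le_div_iff₀ hm0]
  norm_cast
  have hmq : m ≤ 2 * (m / 2) + 1 := by omega
  have hsq : m ^ 2 ≤ 16 * 2 ^ (m / 2) :=
    (Nat.pow_le_pow_left hmq 2).trans (two_mul_add_one_sq_le _)
  have hpow : 2 ^ (m / 2) * 2 ^ (m / 2) ≤ 2 ^ m := by
    rw [← pow_add]
    exact Nat.pow_le_pow_right (by norm_num) (by omega)
  have hA : 2 ^ 2 ^ r * (3 * 2 ^ r) * m ≤ 24 * 2 ^ m := by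
    calc 2 ^ 2 ^ r * (3 * 2 ^ r) * m ≤ 2 ^ (m / 2) * (3 * (m / 2)) * m := by
          gcongr
          norm_num
      _ ≤ 2 ^ (m / 2) * (24 * 2 ^ (m / 2)) := by
          rw [mul_assoc]
          refine Nat.mul_le_mul_left _ ?_
          have : 2 * (m / 2) ≤ m := by omega
          nlinarith
      _ ≤ 24 * 2 ^ m := by linarith
  have hB : 2 ^ (m - r) * m ≤ 6 * 2 ^ m := by
    have : 2 ^ (m - r) * 2 ^ r = 2 ^ m := by rw [← pow_add]; congr 1; omega
    have hm4 : m ≤ 4 * 2 ^ r := by rw [pow_succ] at h2; omega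
    nlinarith [Nat.zero_le (2 ^ (m - r))]
  have hC : m ≤ 2 ^ m := Nat.lt_two_pow_self.le
  nlinarith


/-! ### Correlation with random quadratic forms -/

/-- The sign `(-1) ^ b`. -/
noncomputable def sgn (b : Bool) : ℝ := if b then -1 else 1

@[simp] lemma sgn_true : sgn true = -1 := by simp [sgn]

@[simp] lemma sgn_false : sgn false = 1 := by simp [sgn]

lemma sgn_xor (a b : Bool) : sgn (xor a b) = sgn a * sgn b := by
  cases a <;> cases b <;> simp

lemma sgn_mul_self (a : Bool) : sgn a * sgn a = 1 := by
  cases a <;> simp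

lemma abs_sgn (a : Bool) : |sgn a| = 1 := by
  cases a <;> simp

lemma sgn_foldr_xor {l : ℕ} (F : Fin l → Bool) :
    sgn ((List.ofFn F).foldr xor false) = ∏ i, sgn (F i) := by
  induction l with
  | zero => simp
  | succ l ih => rw [List.ofFn_succ, List.foldr_cons, sgn_xor, ih, Fin.prod_univ_succ]

lemma sgn_quadForm {l : ℕ} (a : Fin l × Fin l → Bool) (z : Fin l → Bool) :
    sgn (quadForm a z) = ∏ p, sgn (a p && (z p.1 && z p.2)) := by
  simp [quadForm, sgn_foldr_xor, Fintype.prod_prod_type]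

lemma sgn_and_mul (a u v : Bool) : sgn (a && u) * sgn (a && v) = sgn (a && xor u v) := by
  cases a <;> cases u <;> cases v <;> simp

lemma sum_prod_sgn_and {P : Type*} [Fintype P] [DecidableEq P] (u : P → Bool) :
    ∑ a : P → Bool, ∏ p, sgn (a p && u p) =
      if ∀ p, u p = false then (Fintype.card (P → Bool) : ℝ) else 0 := by
  have h := (Fintype.prod_sum (fun (p : P) (b : Bool) => sgn (b && u p))).symm
  rw [h]
  split_ifs with hu
  · simp only [hu, Bool.and_false, sgn_false]
    simp
  · push Not at hu
    obtain ⟨p, hp⟩ := hu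
    refine Finset.prod_eq_zero (Finset.mem_univ p) ?_
    simp [Bool.eq_true_of_not_eq_false hp]

lemma sum_sgn_quadForm_mul {l : ℕ} (z z' : Fin l → Bool) :
    ∑ a, sgn (quadForm a z) * sgn (quadForm a z') =
      if z = z' then (Fintype.card (Fin l × Fin l → Bool) : ℝ) else 0 := by
  simp only [sgn_quadForm, ← Finset.prod_mul_distrib, sgn_and_mul]
  rw [sum_prod_sgn_and]
  refine if_congr ⟨fun h => ?_, fun h => ?_⟩ rfl rfl
  · funext i
    simpa using h (i, i)
  · simp [h]

/-- By character orthogonality the sum vanishes unless the four matrices `z zᵀ` add to zero mod 2.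
If so, and `z₁`, `z₂` differ at `i`, the diagonal makes exactly two of the vectors equal 1 at `i`;
row `i` says these two coincide, and the diagonal then equates the others. Linear forms would give
only the diagonal relation. -/
lemma sum_sgn_quadForm_mul_four {l : ℕ} (z₁ z₂ z₃ z₄ : Fin l → Bool) :
    ((∑ a, sgn (quadForm a z₁) * sgn (quadForm a z₂) * (sgn (quadForm a z₃) * sgn (quadForm a z₄)) =
        (Fintype.card (Fin l × Fin l → Bool) : ℝ)) ∧
      (z₁ = z₂ ∧ z₃ = z₄ ∨ z₁ = z₃ ∧ z₂ = z₄ ∨ z₁ = z₄ ∧ z₂ = z₃)) ∨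
    ∑ a, sgn (quadForm a z₁) * sgn (quadForm a z₂) *
      (sgn (quadForm a z₃) * sgn (quadForm a z₄)) = 0 := by
  simp only [sgn_quadForm, ← Finset.prod_mul_distrib, sgn_and_mul]
  rw [sum_prod_sgn_and]
  split_ifs with h
  · refine .inl ⟨rfl, ?_⟩
    by_cases h12 : z₁ = z₂
    · subst h12
      refine .inl ⟨rfl, funext fun i => ?_⟩
      simpa using h (i, i)
    obtain ⟨i, hi⟩ := Function.ne_iff.1 h12
    right
    have hii := h (i, i)
    by_cases h13 : z₁ i = z₃ i
    · refine .inl ⟨funext fun j => ?_, funext fun j => ?_⟩ <;>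
      · have hij := h (i, j)
        have hjj := h (j, j)
        simp only at hii hij hjj
        revert hi hii h13 hij hjj
        generalize z₁ i = a₁, z₂ i = a₂, z₃ i = a₃, z₄ i = a₄, z₁ j = b₁, z₂ j = b₂, z₃ j = b₃,
          z₄ j = b₄
        cases a₁ <;> cases a₂ <;> cases a₃ <;> cases a₄ <;> simp <;>
          cases b₁ <;> cases b₂ <;> cases b₃ <;> cases b₄ <;> simp
    · refine .inr ⟨funext fun j => ?_, funext fun j => ?_⟩ <;>
      · have hij := h (i, j)
        have hjj := h (j, j)
        simp only at hii hij hjj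
        revert hi hii h13 hij hjj
        generalize z₁ i = a₁, z₂ i = a₂, z₃ i = a₃, z₄ i = a₄, z₁ j = b₁, z₂ j = b₂, z₃ j = b₃,
          z₄ j = b₄
        cases a₁ <;> cases a₂ <;> cases a₃ <;> cases a₄ <;> simp <;>
          cases b₁ <;> cases b₂ <;> cases b₃ <;> cases b₄ <;> simp
  · exact .inr rfl

/-! ### A fourth-moment Khintchine inequality. -/

section Khintchine

variable {Ω Z : Type*} [Fintype Ω] [Fintype Z] [DecidableEq Z] {χ : Ω → Z → ℝ} {N : ℝ}

lemma sum_sq_eq_of_orthogonal (h2 : ∀ z z', ∑ a, χ a z * χ a z' = if z = z' then N else 0)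
    (w : Z → ℝ) : ∑ a, (∑ z, w z * χ a z) ^ 2 = N * ∑ z, w z ^ 2 := by
  have h : ∀ a, (∑ z, w z * χ a z) ^ 2 = ∑ z, ∑ z', w z * w z' * (χ a z * χ a z') := by
    intro a
    rw [sq, Finset.sum_mul_sum]
    exact Finset.sum_congr rfl fun z _ => Finset.sum_congr rfl fun z' _ => by ring
  simp only [h]
  rw [Finset.sum_comm, Finset.mul_sum]
  refine Finset.sum_congr rfl fun z _ => ?_
  rw [Finset.sum_comm]
  simp only [← Finset.mul_sum, h2]
  simp
  ring

lemma sum_pow_four_le (hN : 0 ≤ N)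
    (h4 : ∀ z₁ z₂ z₃ z₄, ((∑ a, χ a z₁ * χ a z₂ * (χ a z₃ * χ a z₄) = N) ∧
      (z₁ = z₂ ∧ z₃ = z₄ ∨ z₁ = z₃ ∧ z₂ = z₄ ∨ z₁ = z₄ ∧ z₂ = z₃)) ∨
      ∑ a, χ a z₁ * χ a z₂ * (χ a z₃ * χ a z₄) = 0)
    (w : Z → ℝ) : ∑ a, (∑ z, w z * χ a z) ^ 4 ≤ 3 * N * (∑ z, w z ^ 2) ^ 2 := by
  -- One nonnegative term per pairing of the four indices; overlapping pairings are overcounted,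
  -- which is harmless for an upper bound.
  set d : Z → Z → ℝ := fun z z' => if z = z' then w z * w z' else 0 with hd
  have hd0 : ∀ z z', 0 ≤ d z z' := by
    intro z z'
    by_cases h : z = z'
    · simp [hd, h, mul_self_nonneg]
    · simp [hd, h]
  have hdd : ∀ z, d z z = w z * w z := by simp [hd]
  have hexp : ∀ a, (∑ z, w z * χ a z) ^ 4 = ∑ z₁, ∑ z₂, ∑ z₃, ∑ z₄,
      (w z₁ * w z₂ * (w z₃ * w z₄)) * (χ a z₁ * χ a z₂ * (χ a z₃ * χ a z₄)) := by
    intro a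
    rw [show (4 : ℕ) = 2 + 2 from rfl, pow_add, sq, Finset.sum_mul_sum, Finset.sum_mul]
    refine Finset.sum_congr rfl fun z₁ _ => ?_
    rw [Finset.sum_mul]
    refine Finset.sum_congr rfl fun z₂ _ => ?_
    rw [Finset.mul_sum]
    refine Finset.sum_congr rfl fun z₃ _ => ?_
    rw [Finset.mul_sum]
    exact Finset.sum_congr rfl fun z₄ _ => by ring
  have hswap : ∑ a, (∑ z, w z * χ a z) ^ 4 = ∑ z₁, ∑ z₂, ∑ z₃, ∑ z₄,
      (w z₁ * w z₂ * (w z₃ * w z₄)) * ∑ a, (χ a z₁ * χ a z₂ * (χ a z₃ * χ a z₄)) := by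
    simp only [hexp]
    rw [Finset.sum_comm]
    refine Finset.sum_congr rfl fun z₁ _ => ?_
    rw [Finset.sum_comm]
    refine Finset.sum_congr rfl fun z₂ _ => ?_
    rw [Finset.sum_comm]
    refine Finset.sum_congr rfl fun z₃ _ => ?_
    rw [Finset.sum_comm]
    simp only [Finset.mul_sum]
  have hbound : ∀ z₁ z₂ z₃ z₄,
      (w z₁ * w z₂ * (w z₃ * w z₄)) * ∑ a, (χ a z₁ * χ a z₂ * (χ a z₃ * χ a z₄)) ≤
        N * (d z₁ z₂ * d z₃ z₄ + d z₁ z₃ * d z₂ z₄ + d z₁ z₄ * d z₂ z₃) := by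
    intro z₁ z₂ z₃ z₄
    have h1 := mul_nonneg hN (mul_nonneg (hd0 z₁ z₂) (hd0 z₃ z₄))
    have h2 := mul_nonneg hN (mul_nonneg (hd0 z₁ z₃) (hd0 z₂ z₄))
    have h3 := mul_nonneg hN (mul_nonneg (hd0 z₁ z₄) (hd0 z₂ z₃))
    rcases h4 z₁ z₂ z₃ z₄ with ⟨h, h'⟩ | h
    · rw [h]
      rcases h' with ⟨rfl, rfl⟩ | ⟨rfl, rfl⟩ | ⟨rfl, rfl⟩ <;> simp only [hdd] at * <;> nlinarith
    · rw [h]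
      nlinarith
  rw [hswap]
  calc _ ≤ ∑ z₁, ∑ z₂, ∑ z₃, ∑ z₄,
        N * (d z₁ z₂ * d z₃ z₄ + d z₁ z₃ * d z₂ z₄ + d z₁ z₄ * d z₂ z₃) :=
        Finset.sum_le_sum fun z₁ _ => Finset.sum_le_sum fun z₂ _ => Finset.sum_le_sum fun z₃ _ =>
          Finset.sum_le_sum fun z₄ _ => hbound z₁ z₂ z₃ z₄
    _ = 3 * N * (∑ z, w z ^ 2) ^ 2 := by
      simp only [← Finset.mul_sum, Finset.sum_add_distrib]
      have e1 : ∑ z₁, ∑ z₂, ∑ z₃, ∑ z₄, d z₁ z₂ * d z₃ z₄ = (∑ z, w z ^ 2) ^ 2 := by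
        simp [hd, ← Finset.mul_sum, ← Finset.sum_mul, sq]
      have e2 : ∑ z₁, ∑ z₂, ∑ z₃, ∑ z₄, d z₁ z₃ * d z₂ z₄ = (∑ z, w z ^ 2) ^ 2 := by
        simp [hd, ← Finset.mul_sum, ← Finset.sum_mul, sq]
      have e3 : ∑ z₁, ∑ z₂, ∑ z₃, ∑ z₄, d z₁ z₄ * d z₂ z₃ = (∑ z, w z ^ 2) ^ 2 := by
        simp [hd, ← Finset.mul_sum, ← Finset.sum_mul, sq]
      simp only [← Finset.mul_sum] at e1 e2 e3 ⊢
      rw [e1, e2, e3]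
      ring

/-- A Khintchine inequality for families of signs that are fourth-moment independent. -/
lemma mul_sqrt_le_sum_abs (hN : 0 ≤ N)
    (h2 : ∀ z z', ∑ a, χ a z * χ a z' = if z = z' then N else 0)
    (h4 : ∀ z₁ z₂ z₃ z₄, ((∑ a, χ a z₁ * χ a z₂ * (χ a z₃ * χ a z₄) = N) ∧
      (z₁ = z₂ ∧ z₃ = z₄ ∨ z₁ = z₃ ∧ z₂ = z₄ ∨ z₁ = z₄ ∧ z₂ = z₃)) ∨
      ∑ a, χ a z₁ * χ a z₂ * (χ a z₃ * χ a z₄) = 0)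
    (w : Z → ℝ) :
    N * (√(∑ z, w z ^ 2) / 2) ≤ ∑ a, |∑ z, w z * χ a z| := by
  have m2 := sum_sq_eq_of_orthogonal h2 w
  have m4 := sum_pow_four_le hN h4 w
  set V := ∑ z, w z ^ 2
  have hV : 0 ≤ V := Finset.sum_nonneg fun _ _ => sq_nonneg _
  obtain ⟨r, hr⟩ : ∃ r, r = √V := ⟨_, rfl⟩
  have hrV : r ^ 2 = V := by rw [hr, Real.sq_sqrt hV]
  rw [← hr]
  rcases (hr ▸ Real.sqrt_nonneg V : 0 ≤ r).eq_or_lt with h0 | h0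
  · rw [← h0]
    simpa using Finset.sum_nonneg fun _ _ => abs_nonneg _
  -- A pointwise minorant of `|s|` by the moments at hand. The weight `1 / 6` makes the
  -- fourth-moment bound cost half the second-moment term, hence the factor `1 / 2`.
  have key : ∀ s : ℝ, r ^ 2 * s ^ 2 - s ^ 4 / 6 ≤ r ^ 3 * |s| := by
    intro s
    have hs := abs_nonneg s
    rw [← sq_abs s, show s ^ 4 = |s| ^ 4 by rw [← abs_pow, abs_of_nonneg (by positivity)]]
    generalize |s| = t at hs ⊢
    have : 0 ≤ t ^ 3 - 6 * r ^ 2 * t + 6 * r ^ 3 := by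
      nlinarith [mul_nonneg (by positivity : 0 ≤ t + 3 * r) (sq_nonneg (t - 3 / 2 * r)),
        sq_nonneg (t - 3 / 2 * r), mul_nonneg hs (sq_nonneg (t - 3 / 2 * r)),
        mul_nonneg h0.le (sq_nonneg (t - 10 / 7 * r)), mul_nonneg hs (sq_nonneg (t - 10 / 7 * r)),
        pow_pos h0 3]
    nlinarith [mul_nonneg hs this]
  have hsum : r ^ 2 * (N * V) - 3 * N * V ^ 2 / 6 ≤ r ^ 3 * ∑ a, |∑ z, w z * χ a z| := by
    calc _ ≤ r ^ 2 * ∑ a, (∑ z, w z * χ a z) ^ 2 - (∑ a, (∑ z, w z * χ a z) ^ 4) / 6 := by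
          rw [m2]; linarith
      _ = ∑ a, (r ^ 2 * (∑ z, w z * χ a z) ^ 2 - (∑ z, w z * χ a z) ^ 4 / 6) := by
          rw [Finset.sum_sub_distrib, Finset.mul_sum, Finset.sum_div]
      _ ≤ _ := by
          rw [Finset.mul_sum]
          exact Finset.sum_le_sum fun a _ => key _
  rw [← hrV] at hsum
  refine le_of_mul_le_mul_left ?_ (pow_pos h0 3)
  calc r ^ 3 * (N * (r / 2)) = r ^ 2 * (N * r ^ 2) - 3 * N * (r ^ 2) ^ 2 / 6 := by ring
    _ ≤ _ := hsum

end Khintchine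

/-- Some quadratic form, corrected by a sign in every row, correlates with given signs. -/
lemma exists_quadForm_correlation {Y : Type*} [Fintype Y] {l : ℕ} {γ : ℝ} (hγ : 0 < γ)
    (hγ2 : γ < 1 / 2) (hl : l = 0 ∨ 16 * γ ^ 2 * 2 ^ l ≤ 1) (p : Y → (Fin l → Bool) → ℝ)
    (hp : ∀ b z, 0 ≤ p b z) (hp1 : ∑ b, ∑ z, p b z = 1) (G : Y → (Fin l → Bool) → Bool) :
    ∃ (a : Fin l × Fin l → Bool) (T : Y → Bool),
      2 * γ ≤ ∑ b, ∑ z, p b z * (sgn (xor (T b) (quadForm a z)) * sgn (G b z)) := by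
  classical
  -- `T b` is chosen as the sign of the correlation on block `b`.
  suffices h : ∃ a : Fin l × Fin l → Bool,
      2 * γ ≤ ∑ b, |∑ z, p b z * sgn (G b z) * sgn (quadForm a z)| by
    obtain ⟨a, ha⟩ := h
    refine ⟨a, fun b => decide (∑ z, p b z * sgn (G b z) * sgn (quadForm a z) < 0),
      ha.trans_eq (Finset.sum_congr rfl fun b _ => ?_)⟩
    rcases lt_or_ge (∑ z, p b z * sgn (G b z) * sgn (quadForm a z)) 0 with h | h
    · rw [abs_of_neg h, ← Finset.sum_neg_distrib]
      refine Finset.sum_congr rfl fun z _ => ?_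
      simp only [h, decide_true, sgn_xor, sgn_true]
      ring
    · rw [abs_of_nonneg h]
      refine Finset.sum_congr rfl fun z _ => ?_
      simp only [h.not_gt, decide_false, sgn_xor, sgn_false]
      ring
  rcases hl with rfl | hl
  · refine ⟨fun _ => false, ?_⟩
    simp only [Fintype.sum_unique, abs_mul, abs_sgn] at hp1 ⊢
    simp only [abs_of_nonneg (hp _ _), mul_one, hp1]
    linarith
  by_contra! hcon
  set N : ℝ := (Fintype.card (Fin l × Fin l → Bool) : ℝ) with hN
  have hN0 : 0 < N := by rw [hN]; exact_mod_cast Fintype.card_pos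
  have hlt : ∑ a : Fin l × Fin l → Bool,
      ∑ b, |∑ z, p b z * sgn (G b z) * sgn (quadForm a z)| < N * (2 * γ) := by
    calc _ < ∑ a : Fin l × Fin l → Bool, 2 * γ :=
          Finset.sum_lt_sum_of_nonempty Finset.univ_nonempty fun a _ => hcon a
      _ = N * (2 * γ) := by simp [hN]
  rw [Finset.sum_comm] at hlt
  refine hlt.not_ge ?_
  calc N * (2 * γ) = ∑ b, N * ((4 * γ * ∑ z, p b z) / 2) := by
        simp only [← Finset.mul_sum, ← Finset.sum_div, hp1]
        ring
    -- Cauchy–Schwarz on each block, using `16 * γ ^ 2 * 2 ^ l ≤ 1`.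
    _ ≤ ∑ b, N * (√(∑ z, (p b z * sgn (G b z)) ^ 2) / 2) := by
        refine Finset.sum_le_sum fun b _ => ?_
        gcongr
        refine Real.le_sqrt_of_sq_le ?_
        have hcs := sq_sum_le_card_mul_sum_sq (s := Finset.univ) (f := p b)
        have he : ∑ z, (p b z * sgn (G b z)) ^ 2 = ∑ z, p b z ^ 2 :=
          Finset.sum_congr rfl fun z _ => by rw [mul_pow, sq (sgn _), sgn_mul_self, mul_one]
        rw [he]
        simp only [Finset.card_univ, Fintype.card_pi, Fintype.card_bool, Finset.prod_const,
          Fintype.card_fin, Nat.cast_pow, Nat.cast_ofNat] at hcs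
        have h0 : 0 ≤ ∑ z, p b z ^ 2 := Finset.sum_nonneg fun _ _ => sq_nonneg _
        nlinarith [mul_le_mul_of_nonneg_left hcs (by positivity : 0 ≤ 16 * γ ^ 2),
          mul_le_mul_of_nonneg_right hl h0]
    _ ≤ _ := Finset.sum_le_sum fun b _ => mul_sqrt_le_sum_abs hN0.le sum_sgn_quadForm_mul
        sum_sgn_quadForm_mul_four _


/-! ### Agreement probabilities -/

lemma prob_eq_sum {α : Type*} [Fintype α] (H : PMF α) (P : α → Prop) [DecidablePred P] :
    prob H P = ∑ x, if P x then (H x).toReal else 0 := by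
  rw [prob, PMF.toOuterMeasure_apply_fintype, ENNReal.toReal_sum]
  · refine Finset.sum_congr rfl fun x _ => ?_
    simp only [Set.indicator_apply, Set.mem_ofPred_eq]
    split_ifs <;> simp
  · intro x _
    simp only [Set.indicator_apply]
    split_ifs
    · exact H.apply_ne_top x
    · simp

lemma sum_toReal_eq_one {α : Type*} [Fintype α] (H : PMF α) : ∑ x, (H x).toReal = 1 := by
  have h := H.tsum_coe
  rw [tsum_fintype] at h
  rw [← ENNReal.toReal_sum fun x _ => H.apply_ne_top x, h, ENNReal.toReal_one]

lemma prob_agree_eq {α : Type*} [Fintype α] (H : PMF α) (F f : α → Bool) :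
    prob H (fun x => F x = f x) =
      1 / 2 + (∑ x, (H x).toReal * (sgn (F x) * sgn (f x))) / 2 := by
  rw [prob_eq_sum, ← sum_toReal_eq_one H, Finset.sum_div, Finset.sum_div,
    ← Finset.sum_add_distrib]
  refine Finset.sum_congr rfl fun x _ => ?_
  cases F x <;> cases f x <;> simp <;> ring

lemma isCorrelatedOnAll_junta {n m l : ℕ} (hm : 2 ≤ m) (hk : m + l ≤ n)
    (g : (Fin (m + l) → Bool) → Bool) {γ S : ℝ} (hγ : 0 < γ) (hγ2 : γ < 1 / 2)
    (hl : l = 0 ∨ 16 * γ ^ 2 * 2 ^ l ≤ 1)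
    (hS : 68 * (2 ^ m / m) + (l * (l * 2 + 2) + 2) ≤ S) :
    IsCorrelatedOnAll (junta hk g) S γ := by
  classical
  intro H
  set v : Fin (m + l) → (Fin n → Bool) → Bool := fun i x => x (Fin.castLE hk i) with hv
  set y : (Fin n → Bool) → (Fin m → Bool) := fun x i => v (Fin.castAdd l i) x with hy
  set z : (Fin n → Bool) → (Fin l → Bool) := fun x i => v (Fin.natAdd m i) x with hz
  -- The marginal of `H` on the bits that `g` reads.
  set p : (Fin m → Bool) → (Fin l → Bool) → ℝ :=
    fun b c => ∑ x, if y x = b ∧ z x = c then (H x).toReal else 0 with hp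
  have hpush : ∀ F : (Fin m → Bool) → (Fin l → Bool) → ℝ,
      ∑ b, ∑ c, p b c * F b c = ∑ x, (H x).toReal * F (y x) (z x) := by
    intro F
    simp only [hp, Finset.sum_mul]
    refine (Fintype.sum_prod_type' _).symm.trans ?_
    rw [Finset.sum_comm]
    refine Finset.sum_congr rfl fun x _ => ?_
    rw [Fintype.sum_eq_single (y x, z x)]
    · simp
    · rintro ⟨b, c⟩ hbc
      rw [if_neg, zero_mul]
      rintro ⟨h1, h2⟩
      exact hbc (by rw [h1, h2])
  obtain ⟨a, T, hT⟩ := exists_quadForm_correlation hγ hγ2 hl p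
    (fun b c => Finset.sum_nonneg fun x _ => by split_ifs <;> simp)
    (by simpa [sum_toReal_eq_one] using hpush fun _ _ => 1)
    (fun b c => g (Fin.append b c))
  rw [hpush fun b c => sgn (xor (T b) (quadForm a c)) * sgn (g (Fin.append b c))] at hT
  obtain ⟨j, r, rfl, hjr⟩ := exists_shannon_split hm
  have hmem : ∀ i, v i ∈ Set.range fun (i : Fin n) (x : Fin n → Bool) => x i := fun i => ⟨_, rfl⟩
  have hu := hmem ⟨0, by omega⟩
  obtain ⟨C, hC, hCe⟩ := Generates.exists_circuit <|
    (Generates.shannon (fun i => v (Fin.castAdd l i)) (fun i => hmem _) hu T).gate₂ xor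
      (Generates.quadForm a (fun i => v (Fin.natAdd (j + r) i)) (fun i => hmem _) hu)
  refine ⟨C, ?_, ?_⟩
  · refine le_trans ?_ hS
    have hC' : (C.size : ℝ) ≤ ((2 + 2 ^ 2 ^ r * (3 * 2 ^ r) + 3 * 2 ^ j : ℕ) : ℝ) +
        (l * (l * 2 + 2) + 2) := by exact_mod_cast hC
    linarith
  · rw [prob_agree_eq, hCe]
    have hg : ∀ x, junta hk g x = g (Fin.append (y x) (z x)) := by
      intro x
      unfold junta
      congr 1
      funext i
      refine Fin.addCases (fun i => ?_) (fun i => ?_) i <;> simp [hy, hz, hv]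
    simp only [hg]
    linarith

/-! ### Counting circuits -/

lemma exists_enum_gateSeq (n s m : ℕ) (hm : m ≤ s) :
    ∃ (ι : Type) (_ : Fintype ι) (e : ι → GateSeq n m),
      Function.Surjective e ∧ Fintype.card ι ≤ (16 * (n + s) ^ 2) ^ m := by
  induction m with
  | zero => exact ⟨Unit, inferInstance, fun _ => .nil, fun c => by cases c; exact ⟨(), rfl⟩, by simp⟩
  | succ m ih =>
    obtain ⟨ι, _, e, he, hc⟩ := ih (by omega)
    refine ⟨ι × ((Bool → Bool → Bool) × Fin (n + m) × Fin (n + m)), inferInstance,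
      fun q => .snoc (e q.1) ⟨q.2.1, q.2.2.1, q.2.2.2⟩, fun c => ?_, ?_⟩
    · cases c with
      | snoc c g =>
        obtain ⟨i, rfl⟩ := he c
        exact ⟨(i, g.op, g.left, g.right), rfl⟩
    · simp only [Fintype.card_prod, Fintype.card_fin, pow_succ, Fintype.card_pi,
        Finset.prod_const, Finset.card_univ, Fintype.card_bool]
      refine Nat.mul_le_mul (by simpa only [pow_succ] using hc) ?_
      have : n + m ≤ n + s := by omega
      nlinarith

lemma exists_enum_circuit (n s : ℕ) :
    ∃ (ι : Type) (_ : Fintype ι) (e : ι → (Fin n → Bool) → Bool),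
      (∀ C : Circuit n, C.size ≤ s → ∃ i, e i = C.eval) ∧
      Fintype.card ι ≤ (s + 1) * ((n + s) * (16 * (n + s) ^ 2) ^ s) := by
  choose ι hι e he hc using fun m : Fin (s + 1) => exists_enum_gateSeq n s m (by omega)
  refine ⟨Σ m : Fin (s + 1), Fin (n + m) × ι m, inferInstance,
    fun q x => (e q.1 q.2.2).wires x q.2.1, fun C hC => ?_, ?_⟩
  · obtain ⟨i, hi⟩ := he ⟨C.size, by omega⟩ C.gates
    refine ⟨⟨⟨C.size, by omega⟩, C.out, i⟩, ?_⟩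
    funext x
    simp only [hi]
    rfl
  · rw [Fintype.card_sigma]
    calc _ ≤ ∑ _m : Fin (s + 1), (n + s) * (16 * (n + s) ^ 2) ^ s := by
          refine Finset.sum_le_sum fun m _ => ?_
          rw [Fintype.card_prod, Fintype.card_fin]
          rcases Nat.eq_zero_or_pos (n + s) with h0 | h0
          · have : n + (m : ℕ) = 0 := by omega
            rw [this]; simp
          refine Nat.mul_le_mul (by omega) ((hc m).trans ?_)
          exact Nat.pow_le_pow_right (by positivity) (by omega)
      _ = _ := by simp

/-! ### Random functions are hard -/

/-- Exponential moments with `cosh x ≤ exp (x ^ 2 / 2)`; taking the exponent equal to the deviation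
`t` is optimal. Real weights are needed because a circuit gets averaged over the bits the junta
ignores. -/
lemma card_chernoff {Y : Type*} [Fintype Y] [DecidableEq Y] (d : Y → ℝ) (hd : ∀ y, |d y| ≤ 1)
    (t : ℝ) (ht : 0 ≤ t) :
    (Finset.card {g : Y → Bool | t * Fintype.card Y < ∑ y, sgn (g y) * d y} : ℝ) ≤
      2 ^ Fintype.card Y * Real.exp (-(t ^ 2 / 2 * Fintype.card Y)) := by
  set M : ℝ := (Fintype.card Y : ℝ) with hM
  have hsum : ∑ g : Y → Bool, Real.exp (t * ∑ y, sgn (g y) * d y) ≤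
      2 ^ Fintype.card Y * Real.exp (t ^ 2 / 2 * M) := by
    simp only [Finset.mul_sum, Real.exp_sum]
    have h := Fintype.prod_sum (fun (y : Y) (b : Bool) => Real.exp (t * (sgn b * d y)))
    rw [← h]
    calc _ ≤ ∏ _y : Y, 2 * Real.exp (t ^ 2 / 2) := by
          refine Finset.prod_le_prod (fun y _ => by positivity) fun y _ => ?_
          have h1 := Real.cosh_le_exp_half_sq (t * d y)
          rw [Real.cosh_eq] at h1
          have h2 : Real.exp ((t * d y) ^ 2 / 2) ≤ Real.exp (t ^ 2 / 2) := by
            refine Real.exp_le_exp.2 ?_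
            have : d y ^ 2 ≤ 1 := (sq_le_one_iff_abs_le_one _).2 (hd y)
            rw [mul_pow]
            nlinarith [sq_nonneg t]
          simp only [Fintype.sum_bool, sgn_true, sgn_false, one_mul, neg_mul, mul_neg]
          linarith
      _ = _ := by
          rw [Finset.prod_const, Finset.card_univ, mul_pow, ← Real.exp_nat_mul, mul_comm _ M]
  have hcard : (Finset.card {g : Y → Bool | t * M < ∑ y, sgn (g y) * d y} : ℝ) *
      Real.exp (t ^ 2 * M) ≤ ∑ g : Y → Bool, Real.exp (t * ∑ y, sgn (g y) * d y) := by
    rw [← nsmul_eq_mul, ← Finset.sum_const]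
    refine (Finset.sum_le_sum fun g hg => ?_).trans
      (Finset.sum_le_sum_of_subset_of_nonneg (Finset.subset_univ _) fun _ _ _ =>
        (Real.exp_pos _).le)
    rw [Finset.mem_filter] at hg
    refine Real.exp_le_exp.2 ?_
    nlinarith [hg.2]
  have he : Real.exp (-(t ^ 2 / 2 * M)) * Real.exp (t ^ 2 * M) = Real.exp (t ^ 2 / 2 * M) := by
    rw [← Real.exp_add]
    ring_nf
  refine le_of_mul_le_mul_right ?_ (Real.exp_pos (t ^ 2 * M))
  rw [mul_assoc, he]
  exact hcard.trans hsum

lemma prob_uniform_agree_junta {k j : ℕ} (F : (Fin (k + j) → Bool) → Bool)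
    (g : (Fin k → Bool) → Bool) :
    prob (PMF.uniformOfFintype (Fin (k + j) → Bool))
      (fun x => F x = junta (Nat.le_add_right k j) g x) =
    1 / 2 + ((∑ y, sgn (g y) * ((∑ z, sgn (F (Fin.append y z))) / 2 ^ j)) / 2 ^ k) / 2 := by
  rw [prob_agree_eq]
  congr 2
  rw [← (Fin.appendEquiv k j).sum_comp, Fintype.sum_prod_type, Finset.sum_div]
  refine Finset.sum_congr rfl fun y _ => ?_
  rw [Finset.sum_div, Finset.mul_sum, Finset.sum_div]
  refine Finset.sum_congr rfl fun z _ => ?_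
  have hj : junta (Nat.le_add_right k j) g (Fin.append y z) = g y := by
    unfold junta
    congr 1
    funext i
    exact Fin.append_left y z i
  simp only [Fin.appendEquiv, Equiv.coe_fn_mk, hj, PMF.uniformOfFintype_apply]
  simp [pow_add]
  ring

lemma card_agree_le {k n : ℕ} (hk : k ≤ n) (F : (Fin n → Bool) → Bool) {δ : ℝ} (hδ : δ < 0.49)
    [DecidablePred fun g : (Fin k → Bool) → Bool => 1 - δ <
      prob (PMF.uniformOfFintype (Fin n → Bool)) (fun x => F x = junta hk g x)] :
    (Finset.card {g : (Fin k → Bool) → Bool | 1 - δ <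
      prob (PMF.uniformOfFintype (Fin n → Bool)) (fun x => F x = junta hk g x)} : ℝ) ≤
      2 ^ 2 ^ k * Real.exp (-((2 : ℝ) ^ k / 5000)) := by
  obtain ⟨j, rfl⟩ := Nat.exists_eq_add_of_le hk
  -- Agreement above `0.51` means correlation above `0.02`, and `0.02 ^ 2 / 2 = 1 / 5000`.
  have h := card_chernoff (fun y : Fin k → Bool => (∑ z, sgn (F (Fin.append y z))) / 2 ^ j)
    (fun y => by
      rw [abs_div, abs_of_pos (by positivity : (0 : ℝ) < 2 ^ j), div_le_one (by positivity)]
      refine (Finset.abs_sum_le_sum_abs _ _).trans ?_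
      simp [abs_sgn]) 0.02 (by norm_num)
  simp only [Fintype.card_pi, Fintype.card_bool, Finset.prod_const, Finset.card_univ,
    Fintype.card_fin, Nat.cast_pow, Nat.cast_ofNat] at h
  refine le_trans ?_ (h.trans_eq (by norm_num; ring))
  norm_cast
  refine Finset.card_le_card fun g hg => ?_
  rw [Finset.mem_filter] at hg ⊢
  refine ⟨Finset.mem_univ _, ?_⟩
  have h2 := hg.2
  rw [prob_uniform_agree_junta] at h2
  have h3 : (0.02 : ℝ) < (∑ y, sgn (g y) * ((∑ z, sgn (F (Fin.append y z))) / 2 ^ j)) / 2 ^ k := by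
    linarith
  rw [lt_div_iff₀ (by positivity)] at h3
  simpa using h3

lemma le_prob_isHard {k n s : ℕ} (hk : k ≤ n) {δ : ℝ} (hδ : δ < 0.49) (hs : 2 ≤ s) (hns : n ≤ s)
    (hks : 10 ^ 5 * ((s : ℝ) * Real.logb 2 s) ≤ 2 ^ k) :
    1 - (1 / 2 : ℝ) ^ s ≤ prob (PMF.uniformOfFintype ((Fin k → Bool) → Bool))
      (fun g => IsHard (junta hk g) s δ) := by
  classical
  obtain ⟨ι, _, e, he, hc⟩ := exists_enum_circuit n s
  set bad : Finset ((Fin k → Bool) → Bool) := {g | ¬ IsHard (junta hk g) s δ}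
  have hs2 : (2 : ℝ) ≤ s := by exact_mod_cast hs
  have hlog : 0 ≤ Real.log s := Real.log_nonneg (by linarith)
  -- The constant `10 ^ 5` is `20 * 5000`.
  have hexp : (s : ℝ) ^ (20 * s) ≤ Real.exp ((2 : ℝ) ^ k / 5000) := by
    rw [← Real.exp_log (by positivity : (0 : ℝ) < (s : ℝ) ^ (20 * s)), Real.log_pow]
    refine Real.exp_le_exp.2 ?_
    have : Real.log s ≤ Real.logb 2 s := by
      rw [Real.logb, le_div_iff₀ (Real.log_pos (by norm_num))]
      nlinarith [Real.log_two_lt_d9]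
    push_cast
    rw [le_div_iff₀ (by norm_num)]
    nlinarith [mul_le_mul_of_nonneg_left this (by positivity : (0 : ℝ) ≤ s)]
  -- The extra `2 ^ s` leaves failure probability `2 ^ (-s)` after the union bound.
  have hcount : (s + 1) * ((n + s) * (16 * (n + s) ^ 2) ^ s) * 2 ^ s ≤ s ^ (20 * s) := by
    calc _ ≤ (s * s) * ((s * s) * (s ^ 8) ^ s) * s ^ s := by
          have h64 : 64 ≤ s ^ 6 := by simpa using Nat.pow_le_pow_left hs 6
          gcongr
          · nlinarith
          · nlinarith
          · calc 16 * (n + s) ^ 2 ≤ 16 * (s + s) ^ 2 := by gcongr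
              _ = 64 * s ^ 2 := by ring
              _ ≤ s ^ 6 * s ^ 2 := by gcongr
              _ = s ^ 8 := by ring
      _ = s ^ (4 + 9 * s) := by ring
      _ ≤ s ^ (20 * s) := Nat.pow_le_pow_right (by omega) (by omega)
  have hbad : (bad.card : ℝ) ≤ 2 ^ 2 ^ k * (1 / 2) ^ s := by
    have hsub : bad ⊆ Finset.univ.biUnion fun i : ι =>
        ({g : (Fin k → Bool) → Bool | 1 - δ < prob (PMF.uniformOfFintype (Fin n → Bool))
          (fun x => e i x = junta hk g x)} : Finset _) := by
      intro g hg
      have hg' : ¬ IsHard (junta hk g) s δ := by simpa [bad] using hg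
      simp only [IsHard, not_forall, not_le] at hg'
      obtain ⟨C, hC, hlt⟩ := hg'
      obtain ⟨i, hi⟩ := he C hC
      simp only [Finset.mem_biUnion, Finset.mem_univ, true_and, Finset.mem_filter]
      exact ⟨i, by rw [hi]; exact hlt⟩
    have hE : Real.exp (-((2 : ℝ) ^ k / 5000)) * (s : ℝ) ^ (20 * s) ≤ 1 := by
      rw [Real.exp_neg, inv_mul_le_iff₀ (Real.exp_pos _), mul_one]
      exact hexp
    calc (bad.card : ℝ) ≤ ∑ i : ι, 2 ^ 2 ^ k * Real.exp (-((2 : ℝ) ^ k / 5000)) := by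
          refine (Nat.cast_le.2 ((Finset.card_le_card hsub).trans Finset.card_biUnion_le)).trans ?_
          rw [Nat.cast_sum]
          exact Finset.sum_le_sum fun i _ => card_agree_le hk (e i) hδ
      _ = 2 ^ 2 ^ k * (Real.exp (-((2 : ℝ) ^ k / 5000)) * (Fintype.card ι * 2 ^ s)) *
          (1 / 2) ^ s := by
          rw [Finset.sum_const, Finset.card_univ, nsmul_eq_mul, one_div, inv_pow]
          field_simp
      _ ≤ 2 ^ 2 ^ k * (Real.exp (-((2 : ℝ) ^ k / 5000)) * (s : ℝ) ^ (20 * s)) *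
          (1 / 2) ^ s := by
          gcongr
          exact_mod_cast (Nat.mul_le_mul_right _ hc).trans hcount
      _ ≤ 2 ^ 2 ^ k * 1 * (1 / 2) ^ s := by gcongr
      _ = _ := by ring
  have hcard : Fintype.card ((Fin k → Bool) → Bool) = 2 ^ 2 ^ k := by simp
  have hP : prob (PMF.uniformOfFintype ((Fin k → Bool) → Bool))
      (fun g => IsHard (junta hk g) s δ) = (2 ^ 2 ^ k - bad.card : ℝ) / 2 ^ 2 ^ k := by
    have hsplit := Finset.card_filter_add_card_filter_not
      (s := (Finset.univ : Finset ((Fin k → Bool) → Bool)))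
      (p := fun g => IsHard (junta hk g) s δ)
    rw [Finset.card_univ, hcard] at hsplit
    have hsplit' : ((Finset.card {g : (Fin k → Bool) → Bool | IsHard (junta hk g) s δ} : ℕ) : ℝ) =
        2 ^ 2 ^ k - bad.card := by
      rw [eq_sub_iff_add_eq]
      exact_mod_cast hsplit
    rw [prob_eq_sum, ← Finset.sum_filter, ← hsplit']
    simp only [PMF.uniformOfFintype_apply, hcard]
    simp [div_eq_mul_inv]
  rw [hP, le_div_iff₀ (by positivity)]
  nlinarith


/-! ### Choice of parameters -/

/-- The only use of the lower bound on `s` in terms of `γ`: it turns `s γ ^ 2` into a power of `s`,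
which dominates logarithms. -/
lemma rpow_le_mul_sq {s γ ε : ℝ} (hs : 0 < s) (hγ : 0 < γ) (hε : 0 < ε)
    (h : 1 / γ ^ (2 + ε) ≤ s) : s ^ (ε / (2 + ε)) ≤ s * γ ^ 2 := by
  have hγp : 0 < γ ^ (2 + ε) := Real.rpow_pos_of_pos hγ _
  have h1 : 1 ≤ s * γ ^ (2 + ε) := by rwa [div_le_iff₀ hγp] at h
  have h2 : 1 ≤ s ^ (2 / (2 + ε)) * γ ^ 2 := by
    have := Real.one_le_rpow h1 (by positivity : 0 ≤ 2 / (2 + ε))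
    rwa [Real.mul_rpow hs.le hγp.le, ← Real.rpow_mul hγ.le,
      mul_div_cancel₀ _ (by positivity : 2 + ε ≠ 0), Real.rpow_two] at this
  have h3 : s ^ (ε / (2 + ε)) * s ^ (2 / (2 + ε)) = s := by
    rw [← Real.rpow_add hs, ← add_div, add_comm ε, div_self (by positivity), Real.rpow_one]
  calc s ^ (ε / (2 + ε)) = s ^ (ε / (2 + ε)) * 1 := (mul_one _).symm
    _ ≤ s ^ (ε / (2 + ε)) * (s ^ (2 / (2 + ε)) * γ ^ 2) := by gcongr
    _ = s * γ ^ 2 := by rw [← mul_assoc, h3]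

lemma logb_two_sq_le {s θ : ℝ} (hs : 1 ≤ s) (hθ : 0 < θ) :
    Real.logb 2 s ^ 2 ≤ 16 / θ ^ 2 * s ^ θ := by
  have h0 : 0 ≤ Real.log s := Real.log_nonneg hs
  have h1 : Real.log s ≤ s ^ (θ / 2) / (θ / 2) := Real.log_le_rpow_div (by linarith) (by linarith)
  have h2 : Real.logb 2 s ≤ 2 * Real.log s := by
    rw [Real.logb, div_le_iff₀ (Real.log_pos (by norm_num))]
    nlinarith [Real.log_two_gt_d9]
  have h3 : 0 ≤ Real.logb 2 s := Real.logb_nonneg (by norm_num) hs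
  calc Real.logb 2 s ^ 2 ≤ (2 * (s ^ (θ / 2) / (θ / 2))) ^ 2 := by
        gcongr
        linarith
    _ = 16 / θ ^ 2 * (s ^ (θ / 2)) ^ 2 := by field_simp; norm_num
    _ = _ := by
        rw [← Real.rpow_natCast (s ^ (θ / 2)), ← Real.rpow_mul (by linarith)]
        norm_num

lemma exists_block_length {γ : ℝ} (hγ : 0 < γ) : ∃ l : ℕ,
    (l = 0 ∨ 16 * γ ^ 2 * 2 ^ l ≤ 1) ∧ 1 ≤ 32 * γ ^ 2 * 2 ^ l := by
  rcases le_or_gt 1 (1 / (16 * γ ^ 2)) with h | h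
  · obtain ⟨l, hl1, hl2⟩ := exists_nat_pow_near h (one_lt_two : (1 : ℝ) < 2)
    rw [le_div_iff₀ (by positivity)] at hl1
    rw [div_lt_iff₀ (by positivity), pow_succ] at hl2
    exact ⟨l, .inr (by linarith), by linarith⟩
  · rw [div_lt_one (by positivity)] at h
    exact ⟨0, .inl rfl, by linarith⟩

lemma isCorrelatedOnAll_of_parameters {n k s : ℕ} (hk : k ≤ n) {γ ε : ℝ} (hε : 0 < ε)
    (hγ : 0 < γ) (hγ2 : γ < 1 / 2) (hs : 2 ≤ s) (hsγ : 1 / γ ^ (2 + ε) ≤ (s : ℝ))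
    (hk1 : 10 ^ 5 * ((s : ℝ) * Real.logb 2 s) ≤ 2 ^ k)
    (hk2 : (2 : ℝ) ^ k ≤ 2 * 10 ^ 5 * ((s : ℝ) * Real.logb 2 s))
    (g : (Fin k → Bool) → Bool) :
    IsCorrelatedOnAll (junta hk g) ((68 * (64 * 10 ^ 5) / (ε / (2 + ε)) +
      64 / (ε / (2 + ε)) ^ 2 + 2) * ((s : ℝ) * γ ^ 2)) γ := by
  obtain ⟨θ, hθ⟩ : ∃ θ, θ = ε / (2 + ε) := ⟨_, rfl⟩
  have hθ0 : 0 < θ := hθ ▸ by positivity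
  rw [← hθ]
  have hs2 : (2 : ℝ) ≤ s := by exact_mod_cast hs
  have hsθ : (s : ℝ) ^ θ ≤ s * γ ^ 2 := hθ ▸ rpow_le_mul_sq (by linarith) hγ hε hsγ
  have hsθ1 : 1 ≤ (s : ℝ) ^ θ := Real.one_le_rpow (by linarith) hθ0.le
  have hLsq := logb_two_sq_le (by linarith : (1 : ℝ) ≤ s) hθ0
  have hθL : θ * Real.logb 2 s = Real.logb 2 ((s : ℝ) ^ θ) :=
    (Real.logb_rpow_eq_mul_logb_of_pos (by linarith)).symm
  have hL1 : 1 ≤ Real.logb 2 s := by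
    rw [Real.le_logb_iff_rpow_le (by norm_num) (by linarith)]
    simpa using hs2
  set L := Real.logb 2 (s : ℝ) with hL
  have hsL : (s : ℝ) ≤ s * L := by nlinarith
  have hγ4 : γ ^ 2 ≤ 1 / 4 := by nlinarith
  obtain ⟨l, hl, hl'⟩ := exists_block_length hγ
  have hls : (2 : ℝ) ^ l ≤ s := by
    rcases hl with rfl | hl
    · simpa using by linarith
    · nlinarith [pow_pos (two_pos : (0 : ℝ) < 2) l, sq_nonneg γ,
        mul_pos hγ hγ]
  have hlk : l ≤ k := by
    have : (2 : ℝ) ^ l ≤ 2 ^ k := by linarith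
    exact (pow_le_pow_iff_right₀ (by norm_num)).1 this
  have hlL : (l : ℝ) ≤ L := by
    rw [hL, Real.le_logb_iff_rpow_le (by norm_num) (by linarith), Real.rpow_natCast]
    exact hls
  obtain ⟨m, rfl⟩ := Nat.exists_eq_add_of_le' hlk
  rw [pow_add] at hk1 hk2
  have hl0 : (0 : ℝ) < 2 ^ l := by positivity
  have hm0 : (0 : ℝ) < 2 ^ m := by positivity
  have hm1 : 4 * (s * γ ^ 2) ≤ (2 : ℝ) ^ m := by
    rcases hl with rfl | hl
    · rw [pow_zero, mul_one] at hk1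
      nlinarith
    · refine le_of_mul_le_mul_right ?_ hl0
      nlinarith [mul_le_mul_of_nonneg_left hl (by linarith : (0 : ℝ) ≤ s)]
  have hm2 : (2 : ℝ) ^ m ≤ 64 * 10 ^ 5 * (s * γ ^ 2) * L := by
    calc (2 : ℝ) ^ m ≤ 2 ^ m * (32 * γ ^ 2 * 2 ^ l) := le_mul_of_one_le_right hm0.le hl'
      _ = 32 * γ ^ 2 * (2 ^ m * 2 ^ l) := by ring
      _ ≤ 32 * γ ^ 2 * (2 * 10 ^ 5 * (s * L)) := by gcongr
      _ = _ := by ring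
  have hm : 2 ≤ m := by
    have : (2 : ℝ) ^ 2 ≤ 2 ^ m := by linarith
    exact (pow_le_pow_iff_right₀ (by norm_num)).1 this
  -- From `2 ^ m ≥ s γ ^ 2 ≥ s ^ θ`; this cancels the `L` in `hm2`.
  have hmL : θ * L ≤ m := by
    rw [hθL, Real.logb_le_iff_le_rpow (by norm_num) (by linarith), Real.rpow_natCast]
    linarith
  refine isCorrelatedOnAll_junta hm hk g hγ hγ2 hl ?_
  have hA : (2 : ℝ) ^ m / m ≤ 64 * 10 ^ 5 / θ * (s * γ ^ 2) := by
    calc (2 : ℝ) ^ m / m ≤ (64 * 10 ^ 5 * (s * γ ^ 2) * L) / (θ * L) := by gcongr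
      _ = _ := by field_simp
  have hB : (l : ℝ) * (l * 2 + 2) ≤ 64 / θ ^ 2 * (s * γ ^ 2) := by
    have h1 : (l : ℝ) * (l * 2 + 2) ≤ 4 * L ^ 2 := by nlinarith
    have h2 : 16 / θ ^ 2 * (s : ℝ) ^ θ ≤ 16 / θ ^ 2 * (s * γ ^ 2) := by gcongr
    calc _ ≤ 4 * (16 / θ ^ 2 * (s * γ ^ 2)) := by linarith
      _ = _ := by ring
  calc _ ≤ 68 * (64 * 10 ^ 5 / θ * (s * γ ^ 2)) + (64 / θ ^ 2 * (s * γ ^ 2) + 2 * (s * γ ^ 2)) := by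
        gcongr
        linarith
    _ = _ := by ring

end HardcoreTightness

/-! ### Assembly. -/

open HardcoreTightness
theorem mainTheorem1 :
    ∃ c > (0 : ℝ), ∃ a > (0 : ℝ), ∃ b > (0 : ℝ), ∃ N : ℕ,
      ∀ ε : ℝ, 0 < ε → ∃ K > (0 : ℝ),
        ∀ (n s : ℕ) (δ γ : ℝ), N ≤ n → 0 < δ → δ < 0.49 → 0 < γ → γ < 1 / 2 →
          n ≤ s → (s : ℝ) ≤ c * ((2 : ℝ) ^ n / (n : ℝ)) → 1 / γ ^ (2 + ε) ≤ (s : ℝ) →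
          ∃ (k : ℕ) (hk : k < n),
            a * ((s : ℝ) * Real.logb 2 (s : ℝ)) ≤ (2 : ℝ) ^ k ∧
            (2 : ℝ) ^ k ≤ b * ((s : ℝ) * Real.logb 2 (s : ℝ)) ∧
            (∃ g : (Fin k → Bool) → Bool,
              IsHard (junta hk.le g) s δ ∧
              IsCorrelatedOnAll (junta hk.le g) (K * ((s : ℝ) * γ ^ 2)) γ) ∧
            1 - (1 / 2 : ℝ) ^ s ≤
              prob (PMF.uniformOfFintype ((Fin k → Bool) → Bool)) (fun g =>
                IsHard (junta hk.le g) s δ ∧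
                IsCorrelatedOnAll (junta hk.le g) (K * ((s : ℝ) * γ ^ 2)) γ) := by
  refine ⟨1 / (4 * 10 ^ 5), by norm_num, 10 ^ 5, by norm_num, 2 * 10 ^ 5, by norm_num, 2,
    fun ε hε => ⟨68 * (64 * 10 ^ 5) / (ε / (2 + ε)) + 64 / (ε / (2 + ε)) ^ 2 + 2, by positivity,
      fun n s δ γ hn _ hδ hγ hγ2 hns hsc hsγ => ?_⟩⟩
  have hs : 2 ≤ s := hn.trans hns
  have hs2 : (2 : ℝ) ≤ s := by exact_mod_cast hs
  have hn2 : (2 : ℝ) ≤ n := by exact_mod_cast hn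
  have hL1 : 1 ≤ Real.logb 2 s := by
    rw [Real.le_logb_iff_rpow_le (by norm_num) (by linarith)]
    simpa using hs2
  have hpow : (0 : ℝ) < 2 ^ n := by positivity
  rw [mul_div_assoc', le_div_iff₀ (by linarith)] at hsc
  have hLn : Real.logb 2 s ≤ n := by
    rw [Real.logb_le_iff_le_rpow (by norm_num) (by linarith), Real.rpow_natCast]
    nlinarith
  obtain ⟨k, hk1, hk2⟩ := exists_nat_pow_near
    (by nlinarith : (1 : ℝ) ≤ 10 ^ 5 * ((s : ℝ) * Real.logb 2 s)) (one_lt_two : (1 : ℝ) < 2)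
  have hk3 : (2 : ℝ) ^ (k + 1) ≤ 2 * 10 ^ 5 * ((s : ℝ) * Real.logb 2 s) := by
    rw [pow_succ]
    linarith
  -- The choice `c = 1 / (4 * 10 ^ 5)` gives `2 ^ (k + 1) ≤ 2 ^ n / 2`.
  have hkn : k + 1 < n := by
    have : (2 : ℝ) ^ (k + 1) < 2 ^ n := by
      nlinarith [mul_le_mul_of_nonneg_left hLn (by linarith : (0 : ℝ) ≤ s)]
    exact (pow_lt_pow_iff_right₀ (by norm_num)).1 this
  have hcor := isCorrelatedOnAll_of_parameters hkn.le hε hγ hγ2 hs hsγ hk2.le hk3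
  have hhard := le_prob_isHard hkn.le hδ hs hns hk2.le
  refine ⟨k + 1, hkn, hk2.le, hk3, ?_, by simpa only [hcor, and_true] using hhard⟩
  -- The success probability is positive, so a good `g` exists.
  by_contra! hcon
  have hno : ∀ g, ¬ IsHard (junta hkn.le g) s δ := fun g hg => hcon g hg (hcor g)
  classical
  rw [prob_eq_sum] at hhard
  simp only [hno, if_false, Finset.sum_const_zero] at hhard
  have : (1 / 2 : ℝ) ^ s < 1 := pow_lt_one₀ (by norm_num) (by norm_num) (by omega)
  linarith
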